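/- For a finite simple graph $G$ with at least one vertex write $d(G)=2|E(G)|/|V(G)|$ for its average degree, and for $\alpha\in(0,1)$ let $$c_\alpha(G)=\min\{|V(H)| : H\subseteq G \text{ a non-empty subgraph with } d(H)\ge \alpha\, d(G)\}.$$ A set $A\subseteq V(G)$ is a Hamiltonian subset of $G$ if the induced subgraph $G[A]$ contains a Hamiltonian cycle (a cycle, of length at least $3$, through all the vertices of $A$). Let $\log$ be the natural logarithm and $\beta=(6000\log 3)^{-16}$. For every $\alpha$ with $0<\alpha<\frac12$ there is a constant $d_0=d_0(\alpha)$ such that the following holds. Let $G$ be a finite simple graph with average degree $d(G)\ge d_0$, and let $t=c_\alpha(G)$. Then some vertex of $G$ lies in at least $$2^{\beta t/\log^{16} t}$$ distinct Hamiltonian subsets of $G$. -/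

import Mathlib

noncomputable section

namespace SimpleGraph

/-- The average degree `d(G) = 2 |E(G)| / |V(G)|` of a finite graph. -/
def avgDegree {V : Type*} (G : SimpleGraph V) : ℝ :=
  2 * (G.edgeSet.ncard : ℝ) / (Nat.card V : ℝ)

/-- A (nonempty) subgraph `H` of `G` is an `α`-crux if `d(H) ≥ α * d(G)`. -/
def IsCrux {V : Type*} (G : SimpleGraph V) (α : ℝ) (H : G.Subgraph) : Prop :=
  H.verts.Nonempty ∧ α * G.avgDegree ≤ H.coe.avgDegree

/-- The `α`-crux function `c_α(G)`: the least number of vertices of an `α`-crux of `G`. -/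
def cruxSize {V : Type*} (G : SimpleGraph V) (α : ℝ) : ℕ :=
  sInf {m : ℕ | ∃ H : G.Subgraph, G.IsCrux α H ∧ H.verts.ncard = m}

open scoped Classical in
/-- `A` is a Hamiltonian subset of `G` if the induced subgraph `G[A]` contains a Hamiltonian
cycle (in particular `A` has at least three elements). -/
def IsHamiltonianSubset {V : Type*} (G : SimpleGraph V) (A : Set V) : Prop :=
  ∃ (a : A) (p : (G.induce A).Walk a a), p.IsHamiltonianCycle

end SimpleGraph

end

noncomputable section

namespace SimpleGraph

open scoped Classical in
/-- The vertices of `T` outside `X` that have a neighbour in `X`. -/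
def outerNbhd {V : Type*} (G : SimpleGraph V) (T X : Finset V) : Finset V :=
  {y ∈ T | y ∉ X ∧ ∃ x ∈ X, G.Adj x y}

/-- The graph on `V` whose edges are the edges of `G` inside `C`. -/
def within {V : Type*} (G : SimpleGraph V) (C : Finset V) : SimpleGraph V where
  Adj a b := G.Adj a b ∧ a ∈ C ∧ b ∈ C
  symm := ⟨fun _ _ h => ⟨h.1.symm, h.2.2, h.2.1⟩⟩
  loopless := ⟨fun _ h => h.1.ne rfl⟩

section LongCycle

variable {V : Type*} {G : SimpleGraph V}

lemma mem_outerNbhd {T X : Finset V} {y : V} :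
    y ∈ G.outerNbhd T X ↔ y ∈ T ∧ y ∉ X ∧ ∃ x ∈ X, G.Adj x y := by
  classical
  simp [outerNbhd]

lemma within_le (C : Finset V) : G.within C ≤ G := fun _ _ h => h.1

lemma mem_of_mem_support_within {C : Finset V} {x y : V} (hx : x ∈ C)
    (p : (G.within C).Walk x y) : ∀ z ∈ p.support, z ∈ C := by
  induction p with
  | nil => simpa using hx
  | cons h p ih =>
    intro z hz
    rw [Walk.support_cons, List.mem_cons] at hz
    rcases hz with rfl | hz
    · exact hx
    · exact ih h.2.2 z hz

lemma reachable_within_of_closed {C D : Finset V}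
    (hD : ∀ a ∈ D, ∀ b ∈ C, G.Adj a b → b ∈ D) {x y : V} (hx : x ∈ D)
    (h : (G.within C).Reachable x y) : y ∈ D ∧ (G.within D).Reachable x y := by
  obtain ⟨p⟩ := h
  induction p with
  | nil => exact ⟨hx, Reachable.refl _⟩
  | cons h p ih =>
    have hv := hD _ hx _ h.2.2 h.1
    obtain ⟨h1, h2⟩ := ih hv
    refine ⟨h1, Reachable.trans (Adj.reachable ?_) h2⟩
    exact ⟨h.1, hx, hv⟩

open scoped Classical in
/-- The vertices of `C` that can be reached from `u` inside `C`. -/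
def componentWithin (G : SimpleGraph V) (C : Finset V) (u : V) : Finset V :=
  {y ∈ C | (G.within C).Reachable u y}

lemma mem_componentWithin {C : Finset V} {u y : V} :
    y ∈ G.componentWithin C u ↔ y ∈ C ∧ (G.within C).Reachable u y := by
  classical
  simp [componentWithin]

lemma componentWithin_closed {C : Finset V} {u : V} :
    ∀ a ∈ G.componentWithin C u, ∀ b ∈ C, G.Adj a b → b ∈ G.componentWithin C u := by
  intro a ha b hb hab
  rw [mem_componentWithin] at ha ⊢
  refine ⟨hb, ha.2.trans (Adj.reachable ?_)⟩
  exact ⟨hab, ha.1, hb⟩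

open scoped Classical in
lemma sdiff_componentWithin_closed {C : Finset V} {u : V} :
    ∀ a ∈ C \ G.componentWithin C u, ∀ b ∈ C, G.Adj a b → b ∈ C \ G.componentWithin C u := by
  intro a ha b hb hab
  rw [Finset.mem_sdiff] at ha ⊢
  exact ⟨hb, fun h => ha.2 (componentWithin_closed b h a ha.1 hab.symm)⟩

/-- A set `C` hangs from the first vertex `u` of a path `P`: the neighbours of `C` in `T` lie
on `P`, and every vertex of `C` is joined inside `C` to a neighbour of `u`. -/
structure HangsFrom (G : SimpleGraph V) (T C : Finset V) {u a : V} (P : G.Walk u a) : Prop where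
  isPath : P.IsPath
  subset : C ⊆ T
  support_subset : ∀ x ∈ P.support, x ∈ T
  notMem_support : ∀ x ∈ C, x ∉ P.support
  nbhd_subset : ∀ y ∈ G.outerNbhd T C, y ∈ P.support
  joined : ∀ x ∈ C, ∃ z ∈ C, G.Adj u z ∧ (G.within C).Reachable z x

lemma HangsFrom.of_closed {T C D : Finset V} {u a : V} {P : G.Walk u a}
    (h : G.HangsFrom T C P) (hDC : D ⊆ C)
    (hD : ∀ a ∈ D, ∀ b ∈ C, G.Adj a b → b ∈ D) : G.HangsFrom T D P where
  isPath := h.isPath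
  subset := hDC.trans h.subset
  support_subset := h.support_subset
  notMem_support x hx := h.notMem_support x (hDC hx)
  nbhd_subset y hy := by
    rw [mem_outerNbhd] at hy
    obtain ⟨hyT, hyD, x, hx, hxy⟩ := hy
    exact h.nbhd_subset y (mem_outerNbhd.2
      ⟨hyT, fun hyC => hyD (hD x hx y hyC hxy), x, hDC hx, hxy⟩)
  joined x hx := by
    obtain ⟨z, hz, huz, hzx⟩ := h.joined x (hDC hx)
    have := reachable_within_of_closed hD hx hzx.symm
    exact ⟨z, this.1, huz, this.2.symm⟩

/-- In a set connected from `u`, everything but `u` is joined to a neighbour of `u`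
without using `u`. -/
lemma exists_joined_erase [DecidableEq V] {C : Finset V} {u x : V} (hxu : x ≠ u)
    (h : (G.within C).Reachable u x) :
    ∃ z ∈ C.erase u, G.Adj u z ∧ (G.within (C.erase u)).Reachable z x := by
  obtain ⟨p, hp⟩ := h.exists_isPath
  cases p with
  | nil => exact absurd rfl hxu
  | cons hadj q =>
    rename_i z
    rw [Walk.cons_isPath_iff] at hp
    have hz : z ∈ C.erase u := Finset.mem_erase.2 ⟨hadj.1.ne.symm, hadj.2.2⟩
    refine ⟨z, hz, hadj.1, ?_⟩
    have hu := hp.2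
    clear hp hadj h hxu
    induction q with
    | nil => exact Reachable.refl _
    | cons hab q ih =>
      rw [Walk.support_cons, List.mem_cons, not_or] at hu
      have hb : _ ∈ C.erase u :=
        Finset.mem_erase.2 ⟨fun e => hu.2 (e ▸ q.start_mem_support), hab.2.2⟩
      refine Reachable.trans (Adj.reachable ?_) (ih hb hu.2)
      exact ⟨hab.1, hz, hb⟩

lemma exists_hangsFrom_card_le (T : Finset V) {l k : ℕ} (hl : 1 ≤ l) (hlk : 2 * l ≤ k + 1)
    (n : ℕ) : ∀ (C : Finset V) (u a : V) (P : G.Walk u a), C.card = n → G.HangsFrom T C P →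
      l ≤ C.card → ∃ (X : Finset V) (u a : V) (P : G.Walk u a),
        G.HangsFrom T X P ∧ l ≤ X.card ∧ X.card ≤ k := by
  classical
  induction n using Nat.strong_induction_on with
  | _ n ih =>
    intro C v a P hn hC hlC
    by_cases hCk : C.card ≤ k
    · exact ⟨C, v, a, P, hC, hlC, hCk⟩
    obtain ⟨x, hx⟩ : C.Nonempty := Finset.card_pos.1 (by omega)
    obtain ⟨u, hu, hvu, -⟩ := hC.joined x hx
    set D := G.componentWithin C u with hDdef
    have hDC : D ⊆ C := fun y hy => (mem_componentWithin.1 hy).1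
    have huD : u ∈ D := mem_componentWithin.2 ⟨hu, Reachable.refl _⟩
    have hcard := Finset.card_sdiff_add_card_eq_card hDC
    have hDpos : 0 < D.card := Finset.card_pos.2 ⟨u, huD⟩
    by_cases hDe : D = C
    · refine ih (C.erase u).card ?_ (C.erase u) u a (Walk.cons hvu.symm P) rfl ?_ ?_
      · rw [← hn]; exact Finset.card_erase_lt_of_mem hu
      · refine ⟨?_, ?_, ?_, ?_, ?_, ?_⟩
        · rw [Walk.cons_isPath_iff]
          exact ⟨hC.isPath, hC.notMem_support u hu⟩
        · exact (Finset.erase_subset _ _).trans hC.subset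
        · intro y hy
          rw [Walk.support_cons, List.mem_cons] at hy
          rcases hy with rfl | hy
          · exact hC.subset hu
          · exact hC.support_subset y hy
        · intro y hy
          rw [Finset.mem_erase] at hy
          rw [Walk.support_cons, List.mem_cons, not_or]
          exact ⟨hy.1, hC.notMem_support y hy.2⟩
        · intro y hy
          rw [mem_outerNbhd] at hy
          obtain ⟨hyT, hyC, z, hz, hzy⟩ := hy
          rw [Walk.support_cons, List.mem_cons]
          by_cases hyu : y = u
          · exact Or.inl hyu
          · refine Or.inr (hC.nbhd_subset y (mem_outerNbhd.2 ⟨hyT, fun h => hyC ?_, z, ?_, hzy⟩))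
            · exact Finset.mem_erase.2 ⟨hyu, h⟩
            · exact Finset.mem_of_mem_erase hz
        · intro y hy
          rw [Finset.mem_erase] at hy
          exact exists_joined_erase hy.1 (mem_componentWithin.1 (hDe.symm ▸ hy.2 : y ∈ D)).2
      · rw [Finset.card_erase_of_mem hu]; omega
    · have hlt : D.card < C.card := Finset.card_lt_card (hDC.ssubset_of_ne hDe)
      by_cases hbig : l ≤ D.card
      · exact ih D.card (by omega) D v a P rfl (hC.of_closed hDC componentWithin_closed) hbig
      · exact ih (C \ D).card (by omega) (C \ D) v a P rfl
          (hC.of_closed Finset.sdiff_subset sdiff_componentWithin_closed) (by omega)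

/-- A set all of whose subsets of medium size have an outer neighbour contains a connected
subset which is large and closed under adjacency. -/
lemma exists_connected_closed (T : Finset V) {l k : ℕ} (hl : 1 ≤ l) (hlk : 2 * l ≤ k + 1)
    (hexp : ∀ X ⊆ T, l ≤ X.card → X.card ≤ k → (G.outerNbhd T X).Nonempty)
    (n : ℕ) : ∀ C ⊆ T, C.card = n → G.outerNbhd T C = ∅ → l ≤ C.card →
      ∃ D ⊆ T, G.outerNbhd T D = ∅ ∧ k < D.card ∧
        ∃ u ∈ D, ∀ x ∈ D, (G.within D).Reachable u x := by
  classical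
  induction n using Nat.strong_induction_on with
  | _ n ih =>
    intro C hCT hn hC hlC
    by_cases hCk : C.card ≤ k
    · have := hexp C hCT hlC hCk
      simp [hC] at this
    obtain ⟨u, hu⟩ : C.Nonempty := Finset.card_pos.1 (by omega)
    set D := G.componentWithin C u with hDdef
    have hDC : D ⊆ C := fun y hy => (mem_componentWithin.1 hy).1
    have huD : u ∈ D := mem_componentWithin.2 ⟨hu, Reachable.refl _⟩
    have hcard := Finset.card_sdiff_add_card_eq_card hDC
    have hDpos : 0 < D.card := Finset.card_pos.2 ⟨u, huD⟩
    have key : ∀ E ⊆ C, (∀ a ∈ E, ∀ b ∈ C, G.Adj a b → b ∈ E) → G.outerNbhd T E = ∅ := by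
      intro E hEC hE
      rw [Finset.eq_empty_iff_forall_notMem] at hC ⊢
      intro y hy
      rw [mem_outerNbhd] at hy
      obtain ⟨hyT, hyE, x, hx, hxy⟩ := hy
      exact hC y (mem_outerNbhd.2 ⟨hyT, fun h => hyE (hE x hx y h hxy), x, hEC hx, hxy⟩)
    by_cases hDe : D = C
    · refine ⟨C, hCT, hC, by omega, u, hu, fun x hx => ?_⟩
      exact (mem_componentWithin.1 (hDe.symm ▸ hx : x ∈ D)).2
    · have hlt : D.card < C.card := Finset.card_lt_card (hDC.ssubset_of_ne hDe)
      by_cases hbig : l ≤ D.card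
      · exact ih D.card (by omega) D (hDC.trans hCT) rfl (key D hDC componentWithin_closed) hbig
      · exact ih (C \ D).card (by omega) (C \ D) (Finset.sdiff_subset.trans hCT) rfl
          (key _ Finset.sdiff_subset sdiff_componentWithin_closed) (by omega)

lemma HangsFrom.exists_isCycle {T X : Finset V} {u a : V} {P : G.Walk u a}
    (h : G.HangsFrom T X P) {s : ℕ} (hs : 2 ≤ s) (hcard : s ≤ (G.outerNbhd T X).card) :
    ∃ (v : V) (c : G.Walk v v), c.IsCycle ∧ s ≤ c.length ∧ ∀ x ∈ c.support, x ∈ T := by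
  classical
  have hidx : ∀ y ∈ G.outerNbhd T X, ∃ i ≤ P.length, P.getVert i = y := fun y hy => by
    obtain ⟨i, hi, hi'⟩ := Walk.mem_support_iff_exists_getVert.1 (h.nbhd_subset y hy)
    exact ⟨i, hi', hi⟩
  set I : Finset ℕ := {i ∈ Finset.range (P.length + 1) | P.getVert i ∈ G.outerNbhd T X} with hI
  have hsub : G.outerNbhd T X ⊆ I.image P.getVert := by
    intro y hy
    obtain ⟨i, hi, rfl⟩ := hidx y hy
    exact Finset.mem_image_of_mem _ (by simp [hI]; exact ⟨by omega, hy⟩)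
  have hIs : s ≤ I.card :=
    hcard.trans ((Finset.card_le_card hsub).trans Finset.card_image_le)
  have hIne : I.Nonempty := Finset.card_pos.1 (by omega)
  obtain ⟨i, hi, hmax⟩ := I.exists_max_image id hIne
  have his : s ≤ i + 1 := by
    refine hIs.trans ?_
    rw [← Finset.card_range (i + 1)]
    exact Finset.card_le_card fun j hj => Finset.mem_range.2 (Nat.lt_succ_of_le (hmax j hj))
  simp only [hI, Finset.mem_filter, Finset.mem_range] at hi
  obtain ⟨hiP, hy⟩ := hi
  obtain ⟨hyT, hyX, x, hx, hxy⟩ := mem_outerNbhd.1 hy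
  obtain ⟨z, hz, huz, hzx⟩ := h.joined x hx
  obtain ⟨q, hq⟩ := hzx.exists_isPath
  have hqX := mem_of_mem_support_within hz q
  set q' : G.Walk z x := q.mapLe (within_le X) with hq'
  have hq'X : ∀ w ∈ q'.support, w ∈ X := by
    intro w hw
    apply hqX
    simpa [hq'] using hw
  have hq'p : q'.IsPath := by simpa [hq'] using hq
  set R : G.Walk u (P.getVert i) := P.take i with hR
  have hRp : R.IsPath := h.isPath.take i
  have hRP : ∀ w ∈ R.support, w ∈ P.support := fun w hw => (P.isSubwalk_take i).support_subset hw
  have hRl : R.length = i := by simp [hR, Walk.take_length]; omega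
  have hPX : ∀ w ∈ R.support, w ∉ X := fun w hw hwX => h.notMem_support w hwX (hRP w hw)
  have huy : P.getVert i ≠ u := by
    intro e
    have := h.isPath.getVert_injOn (show i ∈ {j | j ≤ P.length} by simp; omega)
      (show 0 ∈ {j | j ≤ P.length} by simp) (by rw [e, Walk.getVert_zero])
    omega
  let K : G.Walk z u := q'.append (Walk.cons hxy R.reverse)
  have hK : K.IsPath := by
    rw [Walk.isPath_def]
    simp only [K, Walk.support_append, Walk.support_cons, List.tail_cons, Walk.support_reverse]
    refine List.Nodup.append hq'p.support_nodup (List.nodup_reverse.2 hRp.support_nodup) ?_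
    intro w hw hw'
    exact hPX w (List.mem_reverse.1 hw') (hq'X w hw)
  refine ⟨u, Walk.cons huz K, ?_, ?_, ?_⟩
  · rw [Walk.cons_isCycle_iff]
    refine ⟨hK, ?_⟩
    simp only [K, Walk.edges_append, Walk.edges_cons, Walk.edges_reverse, List.mem_append,
      List.mem_cons, List.mem_reverse, not_or]
    refine ⟨fun he => ?_, fun he => ?_, fun he => ?_⟩
    · exact hPX u R.start_mem_support (hq'X u (q'.fst_mem_support_of_mem_edges he))
    · rw [Sym2.eq_iff] at he
      rcases he with ⟨e, -⟩ | ⟨e, -⟩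
      · exact hPX u R.start_mem_support (e ▸ hx)
      · exact huy e.symm
    · exact hPX z (R.snd_mem_support_of_mem_edges he) hz
  · simp [K, hRl]; omega
  · intro w hw
    simp only [K, Walk.support_cons, Walk.support_append, List.mem_cons, List.mem_append,
      List.tail_cons, Walk.support_reverse, List.mem_reverse] at hw
    rcases hw with rfl | hw | hw
    · exact h.support_subset _ P.start_mem_support
    · exact h.subset (hq'X w hw)
    · exact h.support_subset w (hRP w hw)

/-- A set whose subsets of medium size have at least `s` outer neighbours contains a cycle of
length at least `s`. -/
lemma exists_isCycle_of_expansion (T : Finset V) {l k s : ℕ} (hl : 1 ≤ l) (hlk : 2 * l ≤ k + 1)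
    (hlT : l ≤ T.card) (hs : 2 ≤ s)
    (hexp : ∀ X ⊆ T, l ≤ X.card → X.card ≤ k → s ≤ (G.outerNbhd T X).card) :
    ∃ (v : V) (c : G.Walk v v), c.IsCycle ∧ s ≤ c.length ∧ ∀ x ∈ c.support, x ∈ T := by
  classical
  have hT : G.outerNbhd T T = ∅ := by
    rw [Finset.eq_empty_iff_forall_notMem]
    intro y hy
    rw [mem_outerNbhd] at hy
    exact hy.2.1 hy.1
  obtain ⟨D, hDT, hD, hkD, u, hu, hconn⟩ := exists_connected_closed T hl hlk
    (fun X hX h1 h2 => Finset.card_pos.1 (by have := hexp X hX h1 h2; omega))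
    T.card T subset_rfl rfl hT hlT
  have hang : G.HangsFrom T (D.erase u) (Walk.nil : G.Walk u u) := by
    refine ⟨Walk.IsPath.nil, (Finset.erase_subset _ _).trans hDT, ?_, ?_, ?_, ?_⟩
    · intro x hx
      simp at hx
      exact hx ▸ hDT hu
    · intro x hx
      simpa using (Finset.mem_erase.1 hx).1
    · intro y hy
      obtain ⟨hyT, hyD, x, hx, hxy⟩ := mem_outerNbhd.1 hy
      by_contra hyu
      have hyu' : y ≠ u := by simpa using hyu
      have : y ∈ G.outerNbhd T D := mem_outerNbhd.2
        ⟨hyT, fun h => hyD (Finset.mem_erase.2 ⟨hyu', h⟩), x, Finset.mem_of_mem_erase hx, hxy⟩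
      simp [hD] at this
    · intro x hx
      rw [Finset.mem_erase] at hx
      exact exists_joined_erase hx.1 (hconn x hx.2)
  obtain ⟨X, u', a, P, hX, hlX, hXk⟩ := exists_hangsFrom_card_le T hl hlk _ _ _ _ _ rfl hang
    (by rw [Finset.card_erase_of_mem hu]; omega)
  exact hX.exists_isCycle hs (hexp X hX.subset hlX hXk)

lemma Walk.IsCycle.card_support_toFinset [DecidableEq V] {v : V} {c : G.Walk v v}
    (hc : c.IsCycle) : c.support.toFinset.card = c.length := by
  have h : c.support.toFinset = c.support.tail.toFinset := by
    ext x
    rw [List.mem_toFinset, List.mem_toFinset]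
    refine ⟨fun hx => ?_, List.mem_of_mem_tail⟩
    rw [← Walk.cons_tail_support, List.mem_cons] at hx
    rcases hx with rfl | hx
    · exact Walk.end_mem_tail_support hc.not_nil
    · exact hx
  rw [h, List.toFinset_card_of_nodup hc.support_nodup]
  simp

open scoped Classical in
/-- The vertex set of a cycle is a Hamiltonian subset. -/
lemma Walk.IsCycle.isHamiltonianSubset {v : V} {c : G.Walk v v}
    (hc : c.IsCycle) : G.IsHamiltonianSubset (c.support.toFinset : Set V) := by
  have hmem : ∀ x ∈ c.support, x ∈ (c.support.toFinset : Set V) := fun x hx => by simpa using hx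
  have hmap := Walk.map_induce c hmem
  refine ⟨⟨v, hmem v c.start_mem_support⟩, c.induce _ hmem, ?_⟩
  rw [Walk.isHamiltonianCycle_iff_isCycle_and_length_eq]
  constructor
  · rw [← Walk.isCycle_map_iff_of_injective
      (f := (Embedding.induce (G := G) (c.support.toFinset : Set V)).toHom)
      Subtype.val_injective, hmap]
    exact hc
  · calc (c.induce _ hmem).length
        = ((c.induce _ hmem).map (Embedding.induce _).toHom).length := (Walk.length_map ..).symm
      _ = c.length := congrArg Walk.length hmap
      _ = c.support.toFinset.card := hc.card_support_toFinset.symm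
      _ = _ := by rw [← Nat.card_eq_fintype_card, Nat.card_coe_set_eq, Set.ncard_coe_finset]

end LongCycle

end SimpleGraph

end

noncomputable section

namespace SimpleGraph

section Expansion

variable {V : Type*} {G : SimpleGraph V}

/-- A family of nonempty sets of size at least `L` in a ground set of size `m` that cannot be
hit by `w` points has at least `exp (w * L / m)` members. -/
lemma exp_le_card_of_forall_exists_disjoint [DecidableEq V] (S : Finset V) (L : ℝ) (w : ℕ)
    (hS : S.Nonempty) : ∀ (F : Finset (Finset V)),
    (∀ A ∈ F, A ⊆ S ∧ L ≤ A.card) →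
    (∀ W : Finset V, W.card ≤ w → ∃ A ∈ F, Disjoint A W) →
    Real.exp (w * L / S.card) ≤ F.card := by
  have hm : (0 : ℝ) < S.card := by exact_mod_cast hS.card_pos
  induction w with
  | zero =>
    intro F hF hW
    obtain ⟨A, hA, -⟩ := hW ∅ (by simp)
    simpa using Finset.card_pos.2 ⟨A, hA⟩
  | succ w ih =>
    intro F hF hW
    obtain ⟨v, hv⟩ : ∃ v, (L / S.card) * F.card ≤ ((F.filter (v ∈ ·)).card : ℝ) := by
      by_contra! hcon
      have h1 : ∑ v ∈ S, ((F.filter (v ∈ ·)).card : ℝ) < ∑ v ∈ S, (L / S.card) * F.card :=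
        Finset.sum_lt_sum_of_nonempty hS fun v _ => hcon v
      have h2 : ∑ v ∈ S, ((F.filter (v ∈ ·)).card : ℝ) = ∑ A ∈ F, (A.card : ℝ) := by
        have := Finset.sum_card_bipartiteAbove_eq_sum_card_bipartiteBelow
          (s := S) (t := F) (fun v A => v ∈ A)
        simp only [Finset.bipartiteAbove, Finset.bipartiteBelow] at this
        have h3 : ∑ A ∈ F, (S.filter (· ∈ A)).card = ∑ A ∈ F, A.card := by
          refine Finset.sum_congr rfl fun A hA => ?_
          congr 1
          rw [Finset.filter_mem_eq_inter, Finset.inter_eq_right.2 (hF A hA).1]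
        rw [h3] at this
        exact_mod_cast this
      have h4 : (F.card : ℝ) * L ≤ ∑ A ∈ F, (A.card : ℝ) := by
        rw [← nsmul_eq_mul]
        exact Finset.card_nsmul_le_sum _ _ _ fun A hA => (hF A hA).2
      rw [h2, Finset.sum_const, nsmul_eq_mul] at h1
      have : (S.card : ℝ) * (L / S.card * F.card) = F.card * L := by field_simp
      linarith
    have hrec := ih (F.filter (v ∉ ·)) (fun A hA => hF A (Finset.mem_filter.1 hA).1) (by
      intro W hWc
      obtain ⟨A, hA, hd⟩ := hW (insert v W) ((Finset.card_insert_le _ _).trans (by omega))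
      rw [Finset.disjoint_insert_right] at hd
      exact ⟨A, Finset.mem_filter.2 ⟨hA, hd.1⟩, hd.2⟩)
    have hsplit : ((F.filter (v ∈ ·)).card : ℝ) + (F.filter (v ∉ ·)).card = F.card := by
      exact_mod_cast Finset.card_filter_add_card_filter_not (s := F) (v ∈ ·)
    have he : ((F.filter (v ∉ ·)).card : ℝ) ≤ Real.exp (-(L / S.card)) * F.card := by
      have := Real.add_one_le_exp (-(L / S.card))
      nlinarith [(Nat.cast_nonneg F.card : (0 : ℝ) ≤ F.card)]
    have hsum : ((w + 1 : ℕ) : ℝ) * L / S.card = w * L / S.card + L / S.card := by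
      push_cast; ring
    rw [hsum, Real.exp_add]
    calc Real.exp (w * L / S.card) * Real.exp (L / S.card)
        ≤ (Real.exp (-(L / S.card)) * F.card) * Real.exp (L / S.card) := by
          gcongr; exact hrec.trans he
      _ = F.card := by
          rw [mul_right_comm, ← Real.exp_add]; simp

/-- Some point lies in at least a `1 / |S|` share of a family of nonempty subsets of `S`. -/
lemma exists_card_le_card_mul_card_filter [DecidableEq V] (S : Finset V) (hS : S.Nonempty)
    (F : Finset (Finset V)) (hF : ∀ A ∈ F, A ⊆ S ∧ A.Nonempty) :
    ∃ v, F.card ≤ S.card * (F.filter (v ∈ ·)).card := by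
  obtain ⟨v, -, hv⟩ := S.exists_max_image (fun v => (F.filter (v ∈ ·)).card) hS
  refine ⟨v, ?_⟩
  have hsub : F ⊆ S.biUnion fun v => F.filter (v ∈ ·) := by
    intro A hA
    obtain ⟨x, hx⟩ := (hF A hA).2
    exact Finset.mem_biUnion.2 ⟨x, (hF A hA).1 hx, Finset.mem_filter.2 ⟨hA, hx⟩⟩
  calc F.card ≤ _ := Finset.card_le_card hsub
    _ ≤ _ := Finset.card_biUnion_le_card_mul _ _ _ hv

open scoped Classical in
/-- The number of ordered pairs of adjacent vertices of `S`. -/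
def pairCount (G : SimpleGraph V) (S : Finset V) : ℕ :=
  ((S ×ˢ S).filter fun p => G.Adj p.1 p.2).card

lemma pairCount_eq_two_mul_ncard [Fintype V] :
    G.pairCount Finset.univ = 2 * G.edgeSet.ncard := by
  classical
  have h1 : G.edgeSet.ncard = G.edgeFinset.card := by
    rw [← coe_edgeFinset, Set.ncard_coe_finset]
  rw [h1, ← G.sum_degrees_eq_twice_card_edges, pairCount, Finset.card_filter,
    Finset.sum_product]
  refine Finset.sum_congr rfl fun v _ => ?_
  rw [← Finset.card_filter, ← card_neighborFinset_eq_degree]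
  congr 1
  ext w
  simp

lemma avgDegree_eq [Fintype V] :
    G.avgDegree = (G.pairCount Finset.univ : ℝ) / (Finset.univ : Finset V).card := by
  rw [avgDegree, pairCount_eq_two_mul_ncard]
  simp

lemma pairCount_le_sq (S : Finset V) : G.pairCount S ≤ S.card * S.card := by
  classical
  rw [pairCount, ← Finset.card_product]
  exact Finset.card_filter_le _ _

lemma avgDegree_le_card [Finite V] : G.avgDegree ≤ Nat.card V := by
  classical
  have := Fintype.ofFinite V
  rw [avgDegree_eq, Nat.card_eq_fintype_card, ← Finset.card_univ]
  have h : (G.pairCount Finset.univ : ℝ) ≤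
      (Finset.univ : Finset V).card * (Finset.univ : Finset V).card := by
    exact_mod_cast G.pairCount_le_sq Finset.univ
  exact div_le_of_le_mul₀ (by positivity) (by positivity) h

lemma avgDegree_induce (S : Finset V) :
    ((⊤ : G.Subgraph).induce (S : Set V)).coe.avgDegree = (G.pairCount S : ℝ) / S.card := by
  classical
  have : Fintype ((⊤ : G.Subgraph).induce (S : Set V)).verts :=
    inferInstanceAs (Fintype (S : Set V))
  rw [avgDegree_eq, pairCount, pairCount]
  congr 2
  · refine Finset.card_bij (fun p _ => (p.1.1, p.2.1)) ?_ ?_ ?_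
    · rintro ⟨⟨a, ha⟩, ⟨b, hb⟩⟩ h
      simp at h ha hb ⊢
      tauto
    · rintro ⟨⟨a, ha⟩, ⟨b, hb⟩⟩ - ⟨⟨a', ha'⟩, ⟨b', hb'⟩⟩ - h
      simpa using h
    · rintro ⟨a, b⟩ h
      simp at h
      refine ⟨(⟨a, by simpa using h.1.1⟩, ⟨b, by simpa using h.1.2⟩), ?_, rfl⟩
      simp
      tauto
  · rw [Finset.card_univ, ← Nat.card_eq_fintype_card]
    simp

lemma cruxSize_le_card [Finite V] {α : ℝ} {S : Finset V} (hS : S.Nonempty)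
    (h : α * G.avgDegree ≤ (G.pairCount S : ℝ) / S.card) : G.cruxSize α ≤ S.card := by
  refine Nat.sInf_le ⟨(⊤ : G.Subgraph).induce (S : Set V), ⟨?_, ?_⟩, ?_⟩
  · simpa using hS
  · rwa [avgDegree_induce]
  · simp

lemma le_cruxSize [Finite V] {α : ℝ} {S : Finset V} (hS : S.Nonempty)
    (h : α * G.avgDegree ≤ (G.pairCount S : ℝ) / S.card) :
    α * G.avgDegree ≤ G.cruxSize α := by
  have hne : {m : ℕ | ∃ H : G.Subgraph, G.IsCrux α H ∧ H.verts.ncard = m}.Nonempty :=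
    ⟨_, (⊤ : G.Subgraph).induce (S : Set V), ⟨by simpa using hS, by rwa [avgDegree_induce]⟩, rfl⟩
  obtain ⟨H, hH, hcard⟩ := Nat.sInf_mem hne
  rw [cruxSize, ← hcard]
  exact hH.2.trans avgDegree_le_card

/-- The weight function of the extremal argument: decreasing, with values in `[1, 2]`. -/
def sizeWeight (x : ℝ) : ℝ := 1 + 1 / (1 + Real.log x)

lemma one_le_sizeWeight {x : ℝ} (hx : 1 ≤ x) : 1 ≤ sizeWeight x := by
  have := Real.log_nonneg hx
  unfold sizeWeight
  have : 0 ≤ 1 / (1 + Real.log x) := by positivity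
  linarith

lemma sizeWeight_le_two {x : ℝ} (hx : 1 ≤ x) : sizeWeight x ≤ 2 := by
  have := Real.log_nonneg hx
  unfold sizeWeight
  have : 1 / (1 + Real.log x) ≤ 1 := by
    rw [div_le_one (by positivity)]; linarith
  linarith

lemma sizeWeight_anti {x y : ℝ} (hx : 1 ≤ x) (hxy : x ≤ y) : sizeWeight y ≤ sizeWeight x := by
  have h1 := Real.log_nonneg hx
  have h2 := Real.log_le_log (by linarith) hxy
  unfold sizeWeight
  gcongr

lemma sizeWeight_sub_ge {x y : ℝ} (hx : 1 ≤ x) (hxy : 4 * x ≤ 3 * y) :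
    1 / (4 * (1 + Real.log y) ^ 2) ≤ sizeWeight x - sizeWeight y := by
  have h1 := Real.log_nonneg hx
  have h2 : Real.log x ≤ Real.log y := Real.log_le_log (by linarith) (by linarith)
  have h3 : 1 / 4 ≤ Real.log y - Real.log x := by
    rw [← Real.log_div (by linarith) (by linarith)]
    have h4 := Real.one_sub_inv_le_log_of_pos (x := y / x) (by apply div_pos <;> linarith)
    have h5 : (y / x)⁻¹ ≤ 3 / 4 := by
      rw [inv_div, div_le_iff₀ (by linarith)]; linarith
    linarith
  have h6 : sizeWeight x - sizeWeight y =
      (Real.log y - Real.log x) / ((1 + Real.log x) * (1 + Real.log y)) := by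
    unfold sizeWeight
    have : 1 + Real.log x ≠ 0 := by positivity
    have : 1 + Real.log y ≠ 0 := by have := h1.trans h2; positivity
    field_simp
    ring
  have h7 := h1.trans h2
  rw [h6, div_le_div_iff₀ (by positivity) (by apply mul_pos <;> linarith)]
  nlinarith [mul_nonneg h1 (h1.trans h2), mul_le_mul h2 h2 h1 (h1.trans h2)]

end Expansion

end SimpleGraph

end

noncomputable section

namespace SimpleGraph

section Counting

variable {V : Type*} {G : SimpleGraph V}

open scoped Classical in
lemma pairCount_le_add (S X : Finset V) :
    G.pairCount S ≤ G.pairCount (X ∪ G.outerNbhd S X) + G.pairCount (S \ X) := by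
  rw [pairCount, pairCount, pairCount]
  refine (Finset.card_le_card ?_).trans (Finset.card_union_le _ _)
  have key : ∀ a ∈ X, ∀ b ∈ S, G.Adj a b → b ∈ X ∪ G.outerNbhd S X := by
    intro a ha b hb hab
    by_cases hbX : b ∈ X
    · exact Finset.mem_union_left _ hbX
    · exact Finset.mem_union_right _ (mem_outerNbhd.2 ⟨hb, hbX, a, ha, hab⟩)
  rintro ⟨a, b⟩ h
  simp only [Finset.mem_filter, Finset.mem_product] at h
  obtain ⟨⟨ha, hb⟩, hab⟩ := h
  simp only [Finset.mem_union, Finset.mem_filter, Finset.mem_product, Finset.mem_sdiff]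
  by_cases haX : a ∈ X
  · have := key a haX b hb hab
    rw [Finset.mem_union] at this
    exact Or.inl ⟨⟨Or.inl haX, this⟩, hab⟩
  · by_cases hbX : b ∈ X
    · have := key b hbX a ha hab.symm
      rw [Finset.mem_union] at this
      exact Or.inl ⟨⟨this, Or.inl hbX⟩, hab⟩
    · exact Or.inr ⟨⟨⟨ha, haX⟩, hb, hbX⟩, hab⟩

/-- `S` maximizes the average degree weighted by `sizeWeight`. -/
def IsWeightedDensest (G : SimpleGraph V) (S : Finset V) : Prop :=
  S.Nonempty ∧ ∀ T : Finset V, T.Nonempty →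
    (G.pairCount T : ℝ) / T.card * sizeWeight T.card ≤
      (G.pairCount S : ℝ) / S.card * sizeWeight S.card

lemma exists_isWeightedDensest [Finite V] [Nonempty V] : ∃ S, G.IsWeightedDensest S := by
  classical
  have := Fintype.ofFinite V
  obtain ⟨S, hS, hmax⟩ := (Finset.univ.filter fun S : Finset V => S.Nonempty).exists_max_image
    (fun S => (G.pairCount S : ℝ) / S.card * sizeWeight S.card)
    ⟨Finset.univ, by simp⟩
  exact ⟨S, (Finset.mem_filter.1 hS).2, fun T hT => hmax T (by simpa using hT)⟩

lemma one_le_cast_card {S : Finset V} (hS : S.Nonempty) : (1 : ℝ) ≤ S.card := by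
  exact_mod_cast hS.card_pos

lemma IsWeightedDensest.half_avgDegree_le [Finite V] [Nonempty V] {S : Finset V}
    (h : G.IsWeightedDensest S) : G.avgDegree / 2 ≤ (G.pairCount S : ℝ) / S.card := by
  classical
  have := Fintype.ofFinite V
  have hu := h.2 Finset.univ Finset.univ_nonempty
  rw [← avgDegree_eq] at hu
  have h0 : 0 ≤ G.avgDegree := by unfold avgDegree; positivity
  have h1 := one_le_sizeWeight (one_le_cast_card (Finset.univ_nonempty (α := V)))
  have h2 := sizeWeight_le_two (one_le_cast_card h.1)
  have h3 : 0 ≤ (G.pairCount S : ℝ) / S.card := by positivity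
  nlinarith

lemma IsWeightedDensest.le_card_outerNbhd {S X : Finset V} (h : G.IsWeightedDensest S)
    (hpos : 0 < G.pairCount S) (hX : X ⊆ S) (hlow : (S.card : ℝ) ≤ 8 * X.card)
    (hup : 2 * (X.card : ℝ) ≤ S.card) :
    (S.card : ℝ) / (64 * (1 + Real.log S.card) ^ 2) ≤ (G.outerNbhd S X).card := by
  classical
  have hm := one_le_cast_card h.1
  set m : ℝ := (S.card : ℝ)
  set x : ℝ := (X.card : ℝ)
  set b : ℝ := ((G.outerNbhd S X).card : ℝ)
  have hq : 1 ≤ 1 + Real.log m := by have := Real.log_nonneg hm; linarith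
  have hq2 : 1 ≤ (1 + Real.log m) ^ 2 := one_le_pow₀ hq
  by_cases hb : m ≤ 4 * b
  · rw [div_le_iff₀ (by positivity)]
    nlinarith
  push Not at hb
  have hx0 : 0 < x := by linarith
  have hXne : X.Nonempty := Finset.card_pos.1 ((Nat.cast_pos (α := ℝ)).1 hx0)
  have hx1 : 1 ≤ x := one_le_cast_card hXne
  have hb0 : 0 ≤ b := by positivity
  have hdisj : Disjoint X (G.outerNbhd S X) :=
    Finset.disjoint_left.2 fun y hy hy' => (mem_outerNbhd.1 hy').2.1 hy
  have hc1 : ((X ∪ G.outerNbhd S X).card : ℝ) = x + b := by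
    rw [Finset.card_union_of_disjoint hdisj]; push_cast; rfl
  have hc2 : ((S \ X).card : ℝ) = m - x := by
    rw [Finset.card_sdiff_of_subset hX, Nat.cast_sub (Finset.card_le_card hX)]
  have hne2 : (S \ X).Nonempty := by
    apply Finset.card_pos.1
    have : (0 : ℝ) < (S \ X).card := by rw [hc2]; linarith
    exact_mod_cast this
  have hmx1 : 1 ≤ m - x := hc2 ▸ one_le_cast_card hne2
  have h1 := h.2 _ (hXne.mono (Finset.subset_union_left (s₂ := G.outerNbhd S X)))
  have h2 := h.2 _ hne2
  rw [hc1] at h1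
  rw [hc2] at h2
  have hE : (G.pairCount S : ℝ) ≤
      G.pairCount (X ∪ G.outerNbhd S X) + G.pairCount (S \ X) := by
    exact_mod_cast pairCount_le_add S X
  have hpos' : (0 : ℝ) < G.pairCount S := by exact_mod_cast hpos
  set E : ℝ := (G.pairCount S : ℝ)
  set E1 : ℝ := (G.pairCount (X ∪ G.outerNbhd S X) : ℝ)
  set E2 : ℝ := (G.pairCount (S \ X) : ℝ)
  have hE2nn : 0 ≤ E2 := by positivity
  have hw := one_le_sizeWeight hm
  have hw2 := sizeWeight_le_two hm
  have hanti := sizeWeight_anti hmx1 (show m - x ≤ m by linarith)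
  have hdiff := sizeWeight_sub_ge (x := x + b) (y := m) (by linarith) (by linarith)
  have hw1 : 1 ≤ sizeWeight (x + b) := one_le_sizeWeight (by linarith)
  set g := sizeWeight m
  set g1 := sizeWeight (x + b)
  set g2 := sizeWeight (m - x)
  have h2' : E2 * m ≤ E * (m - x) := by
    have : E2 / (m - x) * g ≤ E / m * g :=
      (mul_le_mul_of_nonneg_left hanti (by positivity)).trans h2
    have := le_of_mul_le_mul_right this (by linarith)
    rwa [div_le_div_iff₀ (by linarith) (by linarith)] at this
  have h1' : E1 * g1 * m ≤ E * g * (x + b) := by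
    rw [div_mul_eq_mul_div, div_mul_eq_mul_div, div_le_div_iff₀ (by linarith) (by linarith)] at h1
    exact h1
  have h3 : E * x ≤ E1 * m := by nlinarith
  have h4 : E * (x * g1) ≤ E * (g * (x + b)) := by nlinarith
  have h5 : x * g1 ≤ g * (x + b) := le_of_mul_le_mul_left h4 hpos'
  have h6 : x * (1 / (4 * (1 + Real.log m) ^ 2)) ≤ 2 * b := by nlinarith
  have h7 : m / (64 * (1 + Real.log m) ^ 2) ≤
      x * (1 / (4 * (1 + Real.log m) ^ 2)) / 2 := by
    rw [mul_one_div, div_div, div_le_div_iff₀ (by positivity) (by positivity)]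
    nlinarith
  linarith

open scoped Classical in
lemma IsWeightedDensest.exists_isHamiltonianSubset {S W : Finset V}
    (h : G.IsWeightedDensest S) (hpos : 0 < G.pairCount S) {b : ℝ}
    (hb : b = (S.card : ℝ) / (64 * (1 + Real.log S.card) ^ 2)) (hb4 : 4 ≤ b)
    (hW : (W.card : ℝ) ≤ b / 2) :
    ∃ A ⊆ S, Disjoint A W ∧ b / 2 ≤ A.card ∧ G.IsHamiltonianSubset (A : Set V) := by
  have hm := one_le_cast_card h.1
  have hq2 : 1 ≤ (1 + Real.log S.card) ^ 2 :=
    one_le_pow₀ (by have := Real.log_nonneg hm; linarith)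
  have hbm : 64 * b ≤ S.card := by
    rw [hb, mul_div_assoc', div_le_iff₀ (by positivity)]
    nlinarith
  have hm256 : 256 ≤ S.card := by
    have : (256 : ℝ) ≤ S.card := by linarith
    exact_mod_cast this
  have hTcard : S.card ≤ (S \ W).card + W.card := by
    rw [← Nat.sub_le_iff_le_add]
    exact Finset.le_card_sdiff W S
  obtain ⟨v, c, hc, hlen, hsupp⟩ := exists_isCycle_of_expansion (G := G) (S \ W)
    (l := S.card / 4) (k := S.card / 2) (s := ⌈b / 2⌉₊) (by omega) (by omega) (by
      have h1 : (S.card : ℝ) ≤ (S \ W).card + W.card := by exact_mod_cast hTcard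
      have h2 : (S.card : ℝ) ≤ 4 * (S \ W).card := by linarith
      have h3 : S.card ≤ 4 * (S \ W).card := by exact_mod_cast h2
      omega) (by
      have : (1 : ℕ) < ⌈b / 2⌉₊ := Nat.lt_ceil.2 (by push_cast; linarith)
      omega) (by
      intro X hX hl hk
      rw [Nat.ceil_le]
      have hXS : X ⊆ S := hX.trans Finset.sdiff_subset
      have h1 := h.le_card_outerNbhd hpos hXS (by
        have : S.card ≤ 8 * X.card := by omega
        exact_mod_cast this) (by
        have : 2 * X.card ≤ S.card := by omega
        exact_mod_cast this)
      rw [← hb] at h1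
      have h2 : G.outerNbhd S X ⊆ G.outerNbhd (S \ W) X ∪ W := by
        intro y hy
        obtain ⟨hyS, hyX, hy'⟩ := mem_outerNbhd.1 hy
        rw [Finset.mem_union]
        by_cases hyW : y ∈ W
        · exact Or.inr hyW
        · exact Or.inl (mem_outerNbhd.2 ⟨Finset.mem_sdiff.2 ⟨hyS, hyW⟩, hyX, hy'⟩)
      have h3 : ((G.outerNbhd S X).card : ℝ) ≤ (G.outerNbhd (S \ W) X).card + W.card := by
        exact_mod_cast (Finset.card_le_card h2).trans (Finset.card_union_le _ _)
      linarith)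
  refine ⟨c.support.toFinset, ?_, ?_, ?_, hc.isHamiltonianSubset⟩
  · intro x hx
    exact (Finset.mem_sdiff.1 (hsupp x (List.mem_toFinset.1 hx))).1
  · rw [Finset.disjoint_left]
    intro x hx
    exact (Finset.mem_sdiff.1 (hsupp x (List.mem_toFinset.1 hx))).2
  · rw [hc.card_support_toFinset]
    exact Nat.ceil_le.1 hlen

/-- A weighted densest set forces a vertex into exponentially many Hamiltonian subsets. -/
lemma IsWeightedDensest.exists_vertex [Finite V] {S : Finset V} (h : G.IsWeightedDensest S)
    (hpos : 0 < G.pairCount S)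
    (hm : 256 * (1 + Real.log S.card) ^ 2 ≤ S.card) :
    ∃ v : V, Real.exp (S.card / (32768 * (1 + Real.log S.card) ^ 4)) / S.card ≤
      ({A : Set V | v ∈ A ∧ G.IsHamiltonianSubset A}.ncard : ℝ) := by
  classical
  have hm1 := one_le_cast_card h.1
  have hq : 1 ≤ 1 + Real.log S.card := by have := Real.log_nonneg hm1; linarith
  obtain ⟨b, hb⟩ : ∃ b : ℝ, b = (S.card : ℝ) / (64 * (1 + Real.log S.card) ^ 2) := ⟨_, rfl⟩
  have hb4 : 4 ≤ b := by
    rw [hb, le_div_iff₀ (by positivity)]; linarith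
  set F : Finset (Finset V) :=
    {A ∈ S.powerset | b / 2 ≤ A.card ∧ G.IsHamiltonianSubset (A : Set V)} with hF
  have hFmem : ∀ A ∈ F, A ⊆ S ∧ b / 2 ≤ A.card ∧ G.IsHamiltonianSubset (A : Set V) := by
    intro A hA
    simpa [hF] using hA
  have hexp := exp_le_card_of_forall_exists_disjoint S (b / 2) ⌊b / 2⌋₊ h.1 F
    (fun A hA => ⟨(hFmem A hA).1, (hFmem A hA).2.1⟩) (by
      intro W hW
      obtain ⟨A, hAS, hAW, hAb, hA⟩ := h.exists_isHamiltonianSubset hpos hb hb4 (W := W)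
        ((Nat.le_floor_iff (by linarith)).1 hW)
      exact ⟨A, by simp [hF, hAS, hAb, hA], hAW⟩)
  obtain ⟨v, hv⟩ := exists_card_le_card_mul_card_filter S h.1 F (fun A hA =>
    ⟨(hFmem A hA).1, Finset.card_pos.1 (by
      have h1 := (hFmem A hA).2.1
      have : (0 : ℝ) < A.card := by linarith
      exact_mod_cast this)⟩)
  refine ⟨v, ?_⟩
  have hfloor : b / 4 ≤ (⌊b / 2⌋₊ : ℝ) := by
    have := Nat.lt_floor_add_one (b / 2)
    linarith
  have hexp' : (S.card : ℝ) / (32768 * (1 + Real.log S.card) ^ 4) ≤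
      ⌊b / 2⌋₊ * (b / 2) / S.card := by
    calc (S.card : ℝ) / (32768 * (1 + Real.log S.card) ^ 4)
        = b / 4 * (b / 2) / S.card := by
          rw [hb]; field_simp; norm_num
      _ ≤ _ := by gcongr
  have hcount : ((F.filter (v ∈ ·)).card : ℝ) ≤
      ({A : Set V | v ∈ A ∧ G.IsHamiltonianSubset A}.ncard : ℝ) := by
    rw [← Set.ncard_coe_finset,
      ← Set.ncard_image_of_injective _ (Finset.coe_injective (α := V))]
    refine Nat.cast_le.2 (Set.ncard_le_ncard ?_ (Set.toFinite _))
    rintro _ ⟨A, hA, rfl⟩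
    rw [Finset.mem_coe, Finset.mem_filter] at hA
    exact ⟨Finset.mem_coe.2 hA.2, (hFmem A hA.1).2.2⟩
  rw [div_le_iff₀ (by linarith)]
  have hv' : (F.card : ℝ) ≤ S.card * (F.filter (v ∈ ·)).card := by exact_mod_cast hv
  calc Real.exp (S.card / (32768 * (1 + Real.log S.card) ^ 4))
      ≤ Real.exp (⌊b / 2⌋₊ * (b / 2) / S.card) := Real.exp_le_exp.2 hexp'
    _ ≤ F.card := hexp
    _ ≤ S.card * (F.filter (v ∈ ·)).card := hv'
    _ ≤ _ := by rw [mul_comm]; gcongr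

end Counting

end SimpleGraph

open Filter in
/-- Polylogarithmic factors are eventually negligible in the exponent. -/
lemma eventually_exponent_bounds : ∀ᶠ x : ℝ in atTop,
    256 * (1 + Real.log x) ^ 2 ≤ x ∧
    x / Real.log x ^ 16 + Real.log x ≤ x / (32768 * (1 + Real.log x) ^ 4) := by
  have hlog : Tendsto Real.log atTop atTop := Real.tendsto_log_atTop
  have h6 : ∀ᶠ x : ℝ in atTop, Real.log x ^ 6 ≤ x := by
    have := (isLittleO_log_rpow_rpow_atTop (s := 1) 6 one_pos).bound one_pos
    filter_upwards [this, eventually_gt_atTop 1] with x hx h1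
    have h0 : 0 < Real.log x := Real.log_pos h1
    rw [Real.rpow_one, Real.norm_of_nonneg (by positivity), Real.norm_of_nonneg (by linarith),
      one_mul] at hx
    exact_mod_cast hx
  filter_upwards [h6, hlog.eventually_ge_atTop (2 ^ 24), eventually_gt_atTop 1] with x hx hL h1
  set L := Real.log x
  have hL1 : 1 ≤ L := by linarith
  have hx0 : 0 < x := by linarith
  have hpow : ∀ k, (1 + L) ^ k ≤ 2 ^ k * L ^ k := fun k => by
    rw [← mul_pow]; exact pow_le_pow_left₀ (by linarith) (by linarith) k
  constructor
  · calc 256 * (1 + L) ^ 2 ≤ 256 * (2 ^ 2 * L ^ 2) := by gcongr; exact hpow 2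
      _ = 1024 * L ^ 2 := by ring
      _ ≤ L * L ^ 2 := by gcongr; linarith
      _ = L ^ 3 := by ring
      _ ≤ L ^ 6 := pow_le_pow_right₀ hL1 (by norm_num)
      _ ≤ x := hx
  · have hA : x / (2 ^ 19 * L ^ 4) ≤ x / (32768 * (1 + L) ^ 4) := by
      apply div_le_div_of_nonneg_left hx0.le (by positivity)
      linarith [hpow 4]
    have hB : x / L ^ 16 ≤ x / (2 ^ 20 * L ^ 4) := by
      apply div_le_div_of_nonneg_left hx0.le (by positivity)
      calc 2 ^ 20 * L ^ 4 ≤ L * L ^ 4 := by gcongr; linarith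
        _ = L ^ 5 := by ring
        _ ≤ L ^ 16 := pow_le_pow_right₀ hL1 (by norm_num)
    have hC : L ≤ x / (2 ^ 20 * L ^ 4) := by
      rw [le_div_iff₀ (by positivity)]
      calc L * (2 ^ 20 * L ^ 4) = 2 ^ 20 * L ^ 5 := by ring
        _ ≤ L * L ^ 5 := by gcongr; linarith
        _ = L ^ 6 := by ring
        _ ≤ x := hx
    have hD : x / (2 ^ 20 * L ^ 4) + x / (2 ^ 20 * L ^ 4) = x / (2 ^ 19 * L ^ 4) := by
      field_simp; norm_num
    linarith

lemma div_log_pow_le_div_log_pow {x y : ℝ} (hx : Real.exp 16 ≤ x) (hxy : x ≤ y) :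
    x / Real.log x ^ 16 ≤ y / Real.log y ^ 16 := by
  have hx0 : 0 < x := (Real.exp_pos _).trans_le hx
  have hy0 : 0 < y := hx0.trans_le hxy
  have hlx : 0 < Real.log x := Real.log_pos ((Real.one_lt_exp_iff.2 (by norm_num)).trans_le hx)
  have hly : 0 < Real.log y := hlx.trans_le (Real.log_le_log hx0 hxy)
  have hmem : ∀ z, Real.exp 16 ≤ z → z ∈ Set.Ici (Real.exp (1 / 16 : ℝ)⁻¹) := fun z hz => by
    simpa using hz
  have h := Real.log_div_self_rpow_antitoneOn (a := 1 / 16) (by norm_num)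
    (hmem x hx) (hmem y (hx.trans hxy)) hxy
  have h16 := pow_le_pow_left₀ (by positivity) h 16
  have hroot : ∀ z : ℝ, 0 < z → (z ^ (1 / 16 : ℝ)) ^ 16 = z := fun z hz => by
    rw [← Real.rpow_natCast, ← Real.rpow_mul hz.le]; norm_num
  rw [div_pow, div_pow, hroot x hx0, hroot y hy0, div_le_div_iff₀ hy0 hx0] at h16
  rw [div_le_div_iff₀ (by positivity) (by positivity)]
  linarith

lemma one_le_log_three_pow : 1 ≤ (6000 * Real.log 3) ^ 16 := by
  have h : 1 ≤ Real.log 3 := by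
    rw [Real.le_log_iff_exp_le (by norm_num)]
    linarith [Real.exp_one_lt_d9]
  exact one_le_pow₀ (by linarith)

end

theorem theorem1p2 (α : ℝ) (hα₀ : 0 < α) (hα₁ : α < 1 / 2) :
    ∃ d₀ : ℝ, ∀ (V : Type*) [Finite V] (G : SimpleGraph V), d₀ ≤ G.avgDegree →
      ∃ v : V,
        (2 : ℝ) ^ (((6000 * Real.log 3) ^ 16)⁻¹ * (G.cruxSize α : ℝ)
            / Real.log (G.cruxSize α : ℝ) ^ 16) ≤
          ({A : Set V | v ∈ A ∧ G.IsHamiltonianSubset A}.ncard : ℝ) := by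
  obtain ⟨M, hM⟩ := Filter.eventually_atTop.1 eventually_exponent_bounds
  refine ⟨max 1 (max M (Real.exp 16) / α), fun V _ G hd => ?_⟩
  have hd1 : 1 ≤ G.avgDegree := (le_max_left _ _).trans hd
  have hdM : max M (Real.exp 16) ≤ α * G.avgDegree := by
    have := (le_max_right _ _).trans hd
    rw [div_le_iff₀ hα₀] at this
    linarith
  have hne : Nonempty V := by
    by_contra hV
    rw [not_nonempty_iff] at hV
    simp [SimpleGraph.avgDegree] at hd1
    linarith
  obtain ⟨S, hS⟩ := G.exists_isWeightedDensest
  have hhalf := hS.half_avgDegree_le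
  have hcrux : α * G.avgDegree ≤ (G.pairCount S : ℝ) / S.card := by nlinarith
  have htS : (G.cruxSize α : ℝ) ≤ S.card := by
    exact_mod_cast SimpleGraph.cruxSize_le_card hS.1 hcrux
  have htM := hdM.trans (SimpleGraph.le_cruxSize hS.1 hcrux)
  have hm1 := SimpleGraph.one_le_cast_card hS.1
  have hpos : 0 < G.pairCount S := by
    rw [Nat.pos_iff_ne_zero]
    intro h0
    rw [h0, Nat.cast_zero, zero_div] at hhalf
    linarith
  obtain ⟨h1, h2⟩ := hM S.card ((le_max_left _ _).trans (htM.trans htS))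
  obtain ⟨v, hv⟩ := hS.exists_vertex hpos h1
  refine ⟨v, le_trans ?_ hv⟩
  have hmono := div_log_pow_le_div_log_pow ((le_max_right _ _).trans htM) htS
  set t : ℝ := (G.cruxSize α : ℝ)
  set m : ℝ := (S.card : ℝ)
  have ht1 : 1 < t := lt_of_lt_of_le (Real.one_lt_exp_iff.2 (by norm_num))
    ((le_max_right _ _).trans htM)
  have ht0 : 0 ≤ t / Real.log t ^ 16 := by
    have := Real.log_pos ht1
    positivity
  have hβ : ((6000 * Real.log 3) ^ 16)⁻¹ * t / Real.log t ^ 16 ≤ t / Real.log t ^ 16 := by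
    rw [mul_div_assoc]
    exact mul_le_of_le_one_left ht0 (inv_le_one_of_one_le₀ one_le_log_three_pow)
  calc (2 : ℝ) ^ (((6000 * Real.log 3) ^ 16)⁻¹ * t / Real.log t ^ 16)
      ≤ (2 : ℝ) ^ (m / Real.log m ^ 16) :=
        Real.rpow_le_rpow_of_exponent_le (by norm_num) (hβ.trans hmono)
    _ ≤ Real.exp 1 ^ (m / Real.log m ^ 16) := by
        apply Real.rpow_le_rpow (by norm_num) _ (ht0.trans hmono)
        linarith [Real.add_one_le_exp 1]
    _ = Real.exp (m / Real.log m ^ 16) := Real.exp_one_rpow _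
    _ ≤ Real.exp (m / (32768 * (1 + Real.log m) ^ 4) - Real.log m) :=
        Real.exp_le_exp.2 (by linarith)
    _ = Real.exp (m / (32768 * (1 + Real.log m) ^ 4)) / m := by
        rw [Real.exp_sub, Real.exp_log (by linarith)]
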